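/- For a bounded convex domain (non-empty bounded convex open set) $\Omega\subset\mathbb{R}^2$, let $S_0(\Omega)$ be the set of Lipschitz functions $\varphi$ on $\Omega$ such that $|\nabla\varphi|=1$ a.e. in $\Omega$, $\nabla\varphi\in BV(\Omega,\mathbb{R}^2)$ and $\varphi=0$ on $\partial\Omega$ (for the continuous extension of $\varphi$ to $\overline\Omega$). For a cost function $f:[0,2]\to[0,+\infty]$ and $\varphi\in S_0(\Omega)$ put $$\mathcal{J}_f(\varphi)=\int_{J(\nabla\varphi)} f\bigl(|(\nabla\varphi)_+-(\nabla\varphi)_-|\bigr)\,d\mathcal{H}^1,$$ where $J(\nabla\varphi)\subset\Omega$ is the jump line of $\nabla\varphi$ and $(\nabla\varphi)_\pm$ are the traces of $\nabla\varphi$ on its two sides. **Proposition.** Let $f:[0,2]\to[0,+\infty]$. There exists a bounded convex domain $\Omega\subset\mathbb{R}^2$ such that the distance function $\varphi_0(x)=\operatorname{dist}(x,\partial\Omega)$ belongs to $S_0(\Omega)$ and the following holds: if $\varphi_0$ minimizes $\mathcal{J}_f$ over $S_0(\Omega)$, that is, $\mathcal{J}_f(\varphi_0)\le\mathcal{J}_f(\varphi)$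 for all $\varphi\in S_0(\Omega)$, then $$\limsup_{t\to0}\frac{f(t)}{t}\;\le\;2\,\limsup_{t\to2}f(t).$$ Here the upper limits are taken over $t\in(0,2]$ and over $t\in[0,2]$ respectively; the value $t=2$ is included in the second one. -/

import Mathlib

open MeasureTheory Topology
open scoped ENNReal

/-- The Euclidean plane. -/
abbrev Plane : Type := EuclideanSpace ℝ (Fin 2)

/-- A (bounded) convex domain of the plane. -/
structure IsConvexDomain (Ω : Set Plane) : Prop where
  isOpen : IsOpen Ω
  nonempty : Ω.Nonempty
  isBounded : Bornology.IsBounded Ω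
  convex : Convex ℝ Ω

/-- The divergence `∂₁ ψ₁ + ∂₂ ψ₂` of a vector field. -/
noncomputable def divergence (ψ : Plane → Plane) (x : Plane) : ℝ :=
  ∑ i : Fin 2, fderiv ℝ ψ x (EuclideanSpace.single i (1 : ℝ)) i

/-- `u ∈ BV(Ω)` for a scalar function: `u ∈ L¹(Ω)`, and the total variation
`sup {∫_Ω u div ψ : ψ ∈ C¹_c(Ω; ℝ²), |ψ| ≤ 1}` is finite. -/
def IsBV (Ω : Set Plane) (u : Plane → ℝ) : Prop :=
  IntegrableOn u Ω volume ∧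
    ∃ C : ℝ, ∀ ψ : Plane → Plane, ContDiff ℝ 1 ψ → HasCompactSupport ψ → tsupport ψ ⊆ Ω →
      (∀ x, ‖ψ x‖ ≤ 1) → ∫ x in Ω, u x * divergence ψ x ≤ C

/-- `u ∈ BV(Ω, ℝ²)`: both components are in `BV(Ω)`. -/
def IsBVField (Ω : Set Plane) (u : Plane → Plane) : Prop :=
  ∀ i : Fin 2, IsBV Ω (fun x => u x i)

/-- The open half ball of centre `x` and radius `r` on the side of `x` to which `ν` points. -/
def halfBall (x ν : Plane) (r : ℝ) : Set Plane :=
  {y | y ∈ Metric.ball x r ∧ 0 < inner ℝ ν (y - x)}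

/-- `a` is the one-sided trace (one-sided `L¹`-approximate limit) of `u` at `x` on the side
of `ν`. -/
def HasTrace (u : Plane → Plane) (x ν a : Plane) : Prop :=
  Filter.Tendsto (fun r : ℝ => ⨍⁻ y in halfBall x ν r, ‖u y - a‖ₑ ∂volume) (𝓝[>] 0) (𝓝 0)

/-- `x` is a jump point of `u` with unit normal `ν` and distinct traces `a` (on the side of `ν`)
and `b` (on the side of `-ν`). -/
def IsJumpAt (u : Plane → Plane) (x ν a b : Plane) : Prop :=
  ‖ν‖ = 1 ∧ a ≠ b ∧ HasTrace u x ν a ∧ HasTrace u x (-ν) b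

/-- The jump line `J(u)` of `u` in `Ω`. -/
def jumpSet (Ω : Set Plane) (u : Plane → Plane) : Set Plane :=
  {x | x ∈ Ω ∧ ∃ ν a b : Plane, IsJumpAt u x ν a b}

open Classical in
/-- The jump size `|u₊ - u₋|` at a jump point (and `0` elsewhere). The triple `(ν, u₊, u₋)` is
unique up to its exchange with `(-ν, u₋, u₊)`, so the choice does not matter. -/
noncomputable def jumpSize (u : Plane → Plane) (x : Plane) : ℝ :=
  if h : ∃ p : Plane × Plane × Plane, IsJumpAt u x p.1 p.2.1 p.2.2 then
    ‖h.choose.2.1 - h.choose.2.2‖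
  else 0

/-- `S(Ω)`: Lipschitz functions on `Ω` with `|∇φ| = 1` a.e. and `∇φ ∈ BV(Ω)`. -/
def streamFunctions (Ω : Set Plane) : Set (Plane → ℝ) :=
  {φ | (∃ K, LipschitzOnWith K φ Ω) ∧
    (∀ᵐ x ∂(volume.restrict Ω), ‖gradient φ x‖ = 1) ∧ IsBVField Ω (gradient φ)}

/-- `S₀(Ω)`: the elements of `S(Ω)`, extended continuously to the closure of `Ω`, that vanish
on `∂Ω`. -/
def streamFunctionsZero (Ω : Set Plane) : Set (Plane → ℝ) :=
  {φ | φ ∈ streamFunctions Ω ∧ ContinuousOn φ (closure Ω) ∧ ∀ x ∈ frontier Ω, φ x = 0}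

/-- The line energy `∫_{J(∇φ)} f(|(∇φ)₊ - (∇φ)₋|) dℋ¹`. Jump sizes of gradients of elements of
`S(Ω)` lie in `[0, 2]`, so only the values of `f` there matter. -/
noncomputable def lineEnergy (f : ℝ → ℝ≥0∞) (Ω : Set Plane) (φ : Plane → ℝ) : ℝ≥0∞ :=
  ∫⁻ x in jumpSet Ω (gradient φ), f (jumpSize (gradient φ) x) ∂(Measure.hausdorffMeasure 1)

/-- The distance function to the boundary of `Ω`. -/
noncomputable def distBoundary (Ω : Set Plane) (x : Plane) : ℝ :=
  Metric.infDist x (frontier Ω)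

/-! Suppose the inequality fails and pick `A` strictly between its two sides. Then `f < A / 2` on
some interval ending at `2`, while `f t > A * t` for arbitrarily small `t`. For such a `t` put `s =
t / 2`, `c = √(1 - s ^ 2)`, and let the domain be the convex hull of the unit disc and the disc of
radius `1 - c` about `axisVector`. The distance function has a unit segment of jumps of size `2 * s
= t` between the two centres, so its energy is at least `f t` (`le_lineEnergy_distBoundary`). The
competitor `vortex` reverses the sign of the distance to the unit circle inside the disc, which
turns the segment into a single, energetically negligible vortex at the origin. The price is a short
wall beyond the circle, in the cap, where two nearly opposite gradients meet: jumps lie in `[2 * c,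
2]` and the length is at most `4 * s = 2 * t`, so the energy is at most `A / 2 * (2 * t) = A * t < f
t` (`jump_vortex`, `hausdorffMeasure_wall_le`, `lineEnergy_vortex_le`). Hence the distance function
is not a minimizer. Both functions are differences of Lipschitz convex functions, whence the BV
bounds; both gradients are explicit almost everywhere, whence the traces. -/

section ConvexHessian

/-! ### Bounded variation of gradients of convex functions. -/

variable {g : Plane → ℝ} {ψ : Plane → ℝ}

lemma integral_difference_mul_difference (hg : Continuous g) (hψ : Continuous ψ)
    (hc : HasCompactSupport ψ) (a b : Plane) :
    ∫ x, (g (x + a) - g x) * (ψ x - ψ (x - b)) =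
      ∫ x, ψ x * (g (x + a) - g x - g (x + b + a) + g (x + b)) := by
  have hc' : HasCompactSupport (fun x => ψ (x - b)) := by
    simpa [Function.comp_def, sub_eq_add_neg] using hc.comp_homeomorph (Homeomorph.addRight (-b))
  have h1 : Integrable (fun x => (g (x + a) - g x) * ψ x) :=
    Continuous.integrable_of_hasCompactSupport (by fun_prop) hc.mul_left
  have h2 : Integrable (fun x => (g (x + a) - g x) * ψ (x - b)) :=
    Continuous.integrable_of_hasCompactSupport (by fun_prop) hc'.mul_left
  have h3 : Integrable (fun x => (g (x + b + a) - g (x + b)) * ψ x) :=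
    Continuous.integrable_of_hasCompactSupport (by fun_prop) hc.mul_left
  have h4 := integral_add_right_eq_self (μ := volume)
    (fun x : Plane => (g (x + a) - g x) * ψ (x - b)) b
  simp only [add_sub_cancel_right] at h4
  simp only [mul_sub]
  rw [integral_sub h1 h2, ← h4, ← integral_sub h1 h3]
  congr 1
  ext x
  ring

/-- Dominated convergence: the Lipschitz constants bound the quotients, supports stay in a fixed
compact set, and Rademacher gives the limit almost everywhere. The backward step in `ψ` makes the
discrete integration by parts produce a second difference of `g`. -/
lemma tendsto_integral_difference_quotients {K : NNReal} (hg : LipschitzWith K g)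
    (hψ : ContDiff ℝ 1 ψ) (hc : HasCompactSupport ψ) (v w : Plane) :
    Filter.Tendsto (fun n : ℕ => ((n : ℝ) + 1) ^ 2 *
      ∫ x, (g (x + ((n : ℝ) + 1)⁻¹ • v) - g x) * (ψ x - ψ (x - ((n : ℝ) + 1)⁻¹ • w)))
      Filter.atTop (𝓝 (∫ x, fderiv ℝ g x v * fderiv ℝ ψ x w)) := by
  obtain ⟨C, hC⟩ := hψ.lipschitzWith_of_hasCompactSupport hc one_ne_zero
  have hgc := hg.continuous
  have hψc := hC.continuous
  set S := Metric.cthickening ‖w‖ (tsupport ψ) with hS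
  have hScpt : IsCompact S := hc.isCompact.cthickening
  simp_rw [← integral_const_mul]
  have hpos : ∀ n : ℕ, (0 : ℝ) < (n : ℝ) + 1 := fun n => by positivity
  have htop : Filter.Tendsto (fun n : ℕ => ‖((n : ℝ) + 1)‖) Filter.atTop Filter.atTop := by
    have : Filter.Tendsto (fun n : ℕ => ((n : ℝ) + 1)) Filter.atTop Filter.atTop :=
      Filter.tendsto_atTop_add_const_right _ _ tendsto_natCast_atTop_atTop
    refine this.congr fun n => ?_
    rw [Real.norm_of_nonneg (hpos n).le]
  refine tendsto_integral_of_dominated_convergence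
    (S.indicator fun _ => (K * ‖v‖) * (C * ‖w‖)) ?_ ?_ ?_ ?_
  · intro n
    exact Continuous.aestronglyMeasurable (by fun_prop)
  · rw [integrable_indicator_iff hScpt.measurableSet]
    exact integrableOn_const hScpt.measure_ne_top
  · intro n
    refine Filter.Eventually.of_forall fun x => ?_
    have hn := hpos n
    have hinv : ((n : ℝ) + 1)⁻¹ ≤ 1 := inv_le_one_of_one_le₀ (by simp)
    by_cases hx : x ∈ S
    · rw [Set.indicator_of_mem hx]
      have h1 := hg.dist_le_mul (x + ((n : ℝ) + 1)⁻¹ • v) x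
      have h2 := hC.dist_le_mul x (x - ((n : ℝ) + 1)⁻¹ • w)
      rw [Real.dist_eq, dist_self_add_left, norm_smul, norm_inv, Real.norm_of_nonneg hn.le] at h1
      rw [Real.dist_eq, dist_self_sub_right, norm_smul, norm_inv, Real.norm_of_nonneg hn.le] at h2
      rw [norm_mul, norm_mul, norm_pow, Real.norm_of_nonneg hn.le, Real.norm_eq_abs,
        Real.norm_eq_abs]
      calc _ ≤ ((n : ℝ) + 1) ^ 2 * ((K * (((n : ℝ) + 1)⁻¹ * ‖v‖)) *
            (C * (((n : ℝ) + 1)⁻¹ * ‖w‖))) := by gcongr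
        _ = _ := by field_simp
    · rw [Set.indicator_of_notMem hx]
      have h1 : ψ x = 0 := image_eq_zero_of_notMem_tsupport fun h =>
        hx (Metric.self_subset_cthickening _ h)
      have h2 : ψ (x - ((n : ℝ) + 1)⁻¹ • w) = 0 := image_eq_zero_of_notMem_tsupport fun h => by
        refine hx (Metric.mem_cthickening_of_dist_le _ _ _ _ h ?_)
        rw [dist_self_sub_right, norm_smul, norm_inv, Real.norm_of_nonneg hn.le]
        exact mul_le_of_le_one_left (norm_nonneg _) hinv
      simp [h1, h2]
  · filter_upwards [hg.ae_differentiableAt (μ := volume)] with x hx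
    have h1 := hx.hasFDerivAt.lim v htop
    have h2 := ((hψ.differentiable one_ne_zero) x).hasFDerivAt.lim (-w) htop
    have h3 := h1.mul h2.neg
    simp only [map_neg, neg_neg] at h3
    refine h3.congr fun n => ?_
    simp only [smul_eq_mul, smul_neg, ← sub_eq_add_neg]
    ring

/-- Distributional second derivatives commute because second differences are symmetric in the two
increments. -/
lemma integral_fderiv_mul_fderiv_comm {K : NNReal} (hg : LipschitzWith K g)
    (hψ : ContDiff ℝ 1 ψ) (hc : HasCompactSupport ψ) (v w : Plane) :
    ∫ x, fderiv ℝ g x v * fderiv ℝ ψ x w = ∫ x, fderiv ℝ g x w * fderiv ℝ ψ x v := by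
  refine tendsto_nhds_unique (tendsto_integral_difference_quotients hg hψ hc v w) ?_
  refine (tendsto_integral_difference_quotients hg hψ hc w v).congr fun n => ?_
  rw [integral_difference_mul_difference hg.continuous hψ.continuous hc,
    integral_difference_mul_difference hg.continuous hψ.continuous hc]
  congr 2
  ext x
  rw [add_right_comm x]
  ring

/-- The second distributional derivatives of a convex function are nonnegative. -/
lemma integral_fderiv_mul_fderiv_nonpos {K : NNReal} (hg : LipschitzWith K g)
    (hconv : ConvexOn ℝ Set.univ g) (hψ : ContDiff ℝ 1 ψ) (hc : HasCompactSupport ψ)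
    (h0 : ∀ x, 0 ≤ ψ x) (v : Plane) :
    ∫ x, fderiv ℝ g x v * fderiv ℝ ψ x v ≤ 0 := by
  refine le_of_tendsto (tendsto_integral_difference_quotients hg hψ hc v v)
    (Filter.Eventually.of_forall fun n => ?_)
  rw [integral_difference_mul_difference hg.continuous hψ.continuous hc]
  refine mul_nonpos_of_nonneg_of_nonpos (by positivity) (integral_nonpos fun x => ?_)
  refine mul_nonpos_of_nonneg_of_nonpos (h0 x) ?_
  set a := ((n : ℝ) + 1)⁻¹ • v
  have h := hconv.2 (Set.mem_univ x) (Set.mem_univ (x + a + a)) (by norm_num : (0 : ℝ) ≤ 1 / 2)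
    (by norm_num : (0 : ℝ) ≤ 1 / 2) (by norm_num)
  have hmid : (1 / 2 : ℝ) • x + (1 / 2 : ℝ) • (x + a + a) = x + a := by module
  rw [hmid] at h
  simp only [smul_eq_mul] at h
  linarith

lemma integrable_fderiv_mul_fderiv {K : NNReal} (hg : LipschitzWith K g)
    (hψ : ContDiff ℝ 1 ψ) (hc : HasCompactSupport ψ) (v w : Plane) :
    Integrable (fun x => fderiv ℝ g x v * fderiv ℝ ψ x w) := by
  have h1 : Integrable (fun x => fderiv ℝ ψ x w) :=
    ((hψ.continuous_fderiv one_ne_zero).clm_apply continuous_const).integrable_of_hasCompactSupport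
      (hc.fderiv_apply ℝ w)
  refine h1.bdd_mul (c := K * ‖v‖) (measurable_fderiv_apply_const ℝ g v).aestronglyMeasurable ?_
  refine Filter.Eventually.of_forall fun x => ?_
  exact ((fderiv ℝ g x).le_opNorm v).trans
    (mul_le_mul_of_nonneg_right (norm_fderiv_le_of_lipschitz ℝ hg) (norm_nonneg _))

/-- A nonnegative distribution is controlled by its value on a cutoff `η` equal to `1` on `Ω`: since
`|ψ| ≤ η`, positivity applies to both `η + ψ` and `η - ψ`. -/
lemma exists_bound_pure {K : NNReal} (hg : LipschitzWith K g)
    (hconv : ConvexOn ℝ Set.univ g) {Ω : Set Plane} (hΩ : Bornology.IsBounded Ω) (v : Plane) :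
    ∃ C : ℝ, ∀ ψ : Plane → ℝ, ContDiff ℝ 1 ψ → HasCompactSupport ψ → tsupport ψ ⊆ Ω →
      (∀ x, |ψ x| ≤ 1) → |∫ x, fderiv ℝ g x v * fderiv ℝ ψ x v| ≤ C := by
  obtain ⟨R, hR⟩ := hΩ.subset_closedBall 0
  let η : ContDiffBump (0 : Plane) := ⟨max R 1, max R 1 + 1, by positivity, by linarith⟩
  have hη : ContDiff ℝ 1 η := η.contDiff
  have hηc : HasCompactSupport η := η.hasCompactSupport
  refine ⟨-∫ x, fderiv ℝ g x v * fderiv ℝ η x v, fun ψ hψ hc hs hb => ?_⟩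
  have hle : ∀ x, |ψ x| ≤ η x := fun x => by
    by_cases hx : x ∈ Ω
    · rw [η.one_of_mem_closedBall
        (Metric.closedBall_subset_closedBall (le_max_left _ _) (hR hx))]
      exact hb x
    · rw [image_eq_zero_of_notMem_tsupport fun h => hx (hs h), abs_zero]
      exact η.nonneg
  have key1 := integral_fderiv_mul_fderiv_nonpos hg hconv (hη.add hψ) (hηc.add hc)
    (fun x => by have := neg_abs_le (ψ x); have := hle x; change 0 ≤ η x + ψ x; linarith) v
  have key2 := integral_fderiv_mul_fderiv_nonpos hg hconv (hη.sub hψ) (hηc.sub hc)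
    (fun x => by have := le_abs_self (ψ x); have := hle x; change 0 ≤ η x - ψ x; linarith) v
  have e1 : ∀ x, fderiv ℝ (⇑η + ψ) x = fderiv ℝ η x + fderiv ℝ ψ x := fun x =>
    fderiv_add (hη.differentiable one_ne_zero x) (hψ.differentiable one_ne_zero x)
  have e2 : ∀ x, fderiv ℝ (⇑η - ψ) x = fderiv ℝ η x - fderiv ℝ ψ x := fun x =>
    fderiv_sub (hη.differentiable one_ne_zero x) (hψ.differentiable one_ne_zero x)
  have i1 := integrable_fderiv_mul_fderiv hg hη hηc v v
  have i2 := integrable_fderiv_mul_fderiv hg hψ hc v v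
  change ∫ x, fderiv ℝ g x v * fderiv ℝ (⇑η + ψ) x v ≤ 0 at key1
  change ∫ x, fderiv ℝ g x v * fderiv ℝ (⇑η - ψ) x v ≤ 0 at key2
  simp only [e1, e2, add_apply, sub_apply, mul_add, mul_sub] at key1 key2
  rw [integral_add i1 i2] at key1
  rw [integral_sub i1 i2] at key2
  rw [abs_le]
  constructor <;> linarith

/-- Polarization: the pure derivative along `v + w` minus those along `v` and `w` is twice the mixed
one. -/
lemma exists_bound_mixed {K : NNReal} (hg : LipschitzWith K g)
    (hconv : ConvexOn ℝ Set.univ g) {Ω : Set Plane} (hΩ : Bornology.IsBounded Ω) (v w : Plane) :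
    ∃ C : ℝ, ∀ ψ : Plane → ℝ, ContDiff ℝ 1 ψ → HasCompactSupport ψ → tsupport ψ ⊆ Ω →
      (∀ x, |ψ x| ≤ 1) → |∫ x, fderiv ℝ g x v * fderiv ℝ ψ x w| ≤ C := by
  obtain ⟨C₁, h₁⟩ := exists_bound_pure hg hconv hΩ v
  obtain ⟨C₂, h₂⟩ := exists_bound_pure hg hconv hΩ w
  obtain ⟨C₃, h₃⟩ := exists_bound_pure hg hconv hΩ (v + w)
  refine ⟨C₁ + C₂ + C₃, fun ψ hψ hc hs hb => ?_⟩
  have k₁ := abs_le.1 (h₁ ψ hψ hc hs hb)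
  have k₂ := abs_le.1 (h₂ ψ hψ hc hs hb)
  have k₃ := abs_le.1 (h₃ ψ hψ hc hs hb)
  have hsymm := integral_fderiv_mul_fderiv_comm hg hψ hc v w
  have i := integrable_fderiv_mul_fderiv hg hψ hc
  have hexp : ∫ x, fderiv ℝ g x (v + w) * fderiv ℝ ψ x (v + w) =
      (∫ x, fderiv ℝ g x v * fderiv ℝ ψ x v) + (∫ x, fderiv ℝ g x v * fderiv ℝ ψ x w) +
      ((∫ x, fderiv ℝ g x w * fderiv ℝ ψ x v) + ∫ x, fderiv ℝ g x w * fderiv ℝ ψ x w) := by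
    rw [← integral_add (i v v) (i v w), ← integral_add (i w v) (i w w),
      ← integral_add (by exact (i v v).add (i v w)) (by exact (i w v).add (i w w))]
    congr 1
    ext x
    simp only [map_add]
    ring
  rw [hexp] at k₃
  rw [abs_le]
  constructor <;> linarith [k₁.1, k₁.2, k₂.1, k₂.2, k₃.1, k₃.2]

end ConvexHessian

lemma gradient_apply_eq_fderiv (φ : Plane → ℝ) (x : Plane) (i : Fin 2) :
    gradient φ x i = fderiv ℝ φ x (EuclideanSpace.single i (1 : ℝ)) := by
  have h : inner ℝ (gradient φ x) (EuclideanSpace.single i (1 : ℝ)) =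
      fderiv ℝ φ x (EuclideanSpace.single i (1 : ℝ)) := by
    simp [gradient, InnerProductSpace.toDual_symm_apply]
  rw [← h, EuclideanSpace.inner_single_right]
  simp

/-- The gradient of a difference of two convex functions has bounded variation. -/
lemma isBVField_gradient_of_sub_convex {φ g h : Plane → ℝ} {Kg Kh : NNReal} {Ω : Set Plane}
    (hgl : LipschitzWith Kg g) (hhl : LipschitzWith Kh h)
    (hg : ConvexOn ℝ Set.univ g) (hh : ConvexOn ℝ Set.univ h)
    (hΩ : Bornology.IsBounded Ω) (hΩo : IsOpen Ω) (hφ : ∀ x ∈ Ω, φ x = g x - h x) :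
    IsBVField Ω (gradient φ) := by
  have hae : ∀ᵐ x, x ∈ Ω → fderiv ℝ φ x = fderiv ℝ g x - fderiv ℝ h x := by
    filter_upwards [hgl.ae_differentiableAt (μ := volume), hhl.ae_differentiableAt (μ := volume)]
      with x h1 h2 hx
    rw [← fderiv_sub h1 h2]
    exact Filter.EventuallyEq.fderiv_eq
      (Filter.mem_of_superset (hΩo.mem_nhds hx) fun y hy => hφ y hy)
  intro i
  simp only [gradient_apply_eq_fderiv]
  set e : Plane := EuclideanSpace.single i (1 : ℝ)
  have he : ‖e‖ = 1 := by simp [e]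
  refine ⟨?_, ?_⟩
  · refine Measure.integrableOn_of_bounded (M := Kg + Kh) hΩ.measure_lt_top.ne
      (measurable_fderiv_apply_const ℝ φ e).aestronglyMeasurable ?_
    rw [ae_restrict_iff' hΩo.measurableSet]
    filter_upwards [hae] with x hx hxΩ
    rw [hx hxΩ, sub_apply]
    refine (norm_sub_le _ _).trans (add_le_add ?_ ?_)
    · have := (fderiv ℝ g x).le_opNorm e
      rw [he, mul_one] at this
      exact this.trans (norm_fderiv_le_of_lipschitz ℝ hgl)
    · have := (fderiv ℝ h x).le_opNorm e
      rw [he, mul_one] at this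
      exact this.trans (norm_fderiv_le_of_lipschitz ℝ hhl)
  · choose A hA using fun j : Fin 2 =>
      exists_bound_mixed hgl hg hΩ e (EuclideanSpace.single j (1 : ℝ))
    choose B hB using fun j : Fin 2 =>
      exists_bound_mixed hhl hh hΩ e (EuclideanSpace.single j (1 : ℝ))
    refine ⟨∑ j, (A j + B j), fun ψ hψ hc hs hb => ?_⟩
    have hψj : ∀ j, ContDiff ℝ 1 (fun x => ψ x j) := fun j => by fun_prop
    have hcj : ∀ j, HasCompactSupport (fun x => ψ x j) := fun j =>
      hc.comp_left (g := fun y : Plane => y j) rfl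
    have hsj : ∀ j, tsupport (fun x => ψ x j) ⊆ Ω := fun j =>
      (closure_mono fun x hx => by
        contrapose! hx
        simp only [Function.mem_support, not_not] at hx ⊢
        rw [hx]; rfl).trans hs
    have hbj : ∀ j x, |ψ x j| ≤ 1 := fun j x =>
      (PiLp.norm_apply_le (ψ x) j).trans (hb x)
    have hfd : ∀ (x : Plane) (j : Fin 2) (v : Plane),
        fderiv ℝ ψ x v j = fderiv ℝ (fun x => ψ x j) x v := fun x j v => by
      have h1 := (hψ.differentiable one_ne_zero x).hasFDerivAt
      have h2 := (EuclideanSpace.proj (𝕜 := ℝ) j).hasFDerivAt.comp x h1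
      have h3 : fderiv ℝ (fun x => ψ x j) x = _ := h2.fderiv
      rw [h3]
      rfl
    have hint : ∫ x in Ω, fderiv ℝ φ x e * divergence ψ x =
        ∑ j, ((∫ x, fderiv ℝ g x e *
            fderiv ℝ (fun x => ψ x j) x (EuclideanSpace.single j (1 : ℝ))) -
          ∫ x, fderiv ℝ h x e *
            fderiv ℝ (fun x => ψ x j) x (EuclideanSpace.single j (1 : ℝ))) := by
      simp_rw [← fun j => integral_sub
        (integrable_fderiv_mul_fderiv hgl (hψj j) (hcj j) e (EuclideanSpace.single j (1 : ℝ)))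
        (integrable_fderiv_mul_fderiv hhl (hψj j) (hcj j) e (EuclideanSpace.single j (1 : ℝ)))]
      rw [← integral_finsetSum _ fun j _ => by
        exact (integrable_fderiv_mul_fderiv hgl (hψj j) (hcj j) e
          (EuclideanSpace.single j (1 : ℝ))).sub (integrable_fderiv_mul_fderiv hhl (hψj j) (hcj j) e
          (EuclideanSpace.single j (1 : ℝ)))]
      rw [← integral_indicator hΩo.measurableSet]
      refine integral_congr_ae ?_
      filter_upwards [hae] with x hx
      by_cases hxΩ : x ∈ Ω
      · rw [Set.indicator_of_mem hxΩ, hx hxΩ, divergence, Finset.mul_sum]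
        simp only [hfd, sub_apply, sub_mul]
      · rw [Set.indicator_of_notMem hxΩ]
        symm
        refine Finset.sum_eq_zero fun j _ => ?_
        have : fderiv ℝ (fun x => ψ x j) x = 0 :=
          image_eq_zero_of_notMem_tsupport fun h' =>
            hxΩ (hsj j (closure_minimal (support_fderiv_subset ℝ) (isClosed_tsupport _) h'))
        simp [this]
    rw [hint]
    refine Finset.sum_le_sum fun j _ => ?_
    have k1 := abs_le.1 (hA j _ (hψj j) (hcj j) (hsj j) (hbj j))
    have k2 := abs_le.1 (hB j _ (hψj j) (hcj j) (hsj j) (hbj j))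
    linarith [k1.2, k2.1]

/-! ### The height function of the cap domain: definitions. -/

lemma Plane.inner_eq (x y : Plane) : inner ℝ x y = x 0 * y 0 + x 1 * y 1 := by
  simp [PiLp.inner_apply, Fin.sum_univ_two, mul_comm]

lemma Plane.norm_sq_eq (x : Plane) : ‖x‖ ^ 2 = x 0 ^ 2 + x 1 ^ 2 := by
  simp [EuclideanSpace.norm_sq_eq, Fin.sum_univ_two]

/-- `c` and `s` are the cosine and the sine of an angle in `(0, π/2)`. -/
structure IsAcuteAngle (c s : ℝ) : Prop where
  c_pos : 0 < c
  s_pos : 0 < s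
  sq_add_sq : c ^ 2 + s ^ 2 = 1

/-- The unit vector of the axis of symmetry. -/
noncomputable def axisVector : Plane := EuclideanSpace.single 0 (1 : ℝ)

@[simp] lemma axisVector_zero : axisVector 0 = 1 := by simp [axisVector]
@[simp] lemma axisVector_one : axisVector 1 = 0 := by simp [axisVector]
@[simp] lemma norm_axisVector : ‖axisVector‖ = 1 := by simp [axisVector]

/-- The parameter of the point of the ridge below `x`. -/
noncomputable def ridgeParam (c s : ℝ) (x : Plane) : ℝ := max 0 (min 1 (x 0 - c / s * |x 1|))

/-- The point of the ridge below `x`. -/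
noncomputable def ridgePoint (c s : ℝ) (x : Plane) : Plane := ridgeParam c s x • axisVector

/-- The concave function which is positive on the convex hull of the unit disc and a small disc
centred at `axisVector`, where it is the distance to the boundary. -/
noncomputable def height (c s : ℝ) (x : Plane) : ℝ :=
  1 - c * ridgeParam c s x - ‖x - ridgePoint c s x‖

open Classical in
/-- The opposite of a supergradient of `height`. -/
noncomputable def outward (c s : ℝ) (x : Plane) : Plane :=
  if x = ridgePoint c s x then !₂[c, s] else ‖x - ridgePoint c s x‖⁻¹ • (x - ridgePoint c s x)

/-- The convex hull of the unit disc and the disc of radius `1 - c` centred at `axisVector`. -/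
def capDomain (c s : ℝ) : Set Plane := {x | 0 < height c s x}

/-! ### Supporting affine functions, concavity and gradient of the height. -/

section Height

variable {c s : ℝ}

lemma ridgeParam_nonneg (x : Plane) : 0 ≤ ridgeParam c s x := le_max_left _ _

lemma ridgeParam_le_one (x : Plane) : ridgeParam c s x ≤ 1 :=
  max_le zero_le_one (min_le_left _ _)

lemma continuous_ridgeParam : Continuous (ridgeParam c s) := by
  unfold ridgeParam
  fun_prop

lemma continuous_ridgePoint : Continuous (ridgePoint c s) :=
  continuous_ridgeParam.smul continuous_const

lemma continuous_height : Continuous (height c s) := by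
  have := continuous_ridgeParam (c := c) (s := s)
  have := continuous_ridgePoint (c := c) (s := s)
  unfold height
  fun_prop

lemma norm_outward (h : IsAcuteAngle c s) (x : Plane) : ‖outward c s x‖ = 1 := by
  unfold outward
  split_ifs with hx
  · have := Plane.norm_sq_eq !₂[c, s]
    simp only [Matrix.cons_val_zero, Matrix.cons_val_one, h.sq_add_sq] at this
    exact (pow_eq_one_iff_of_nonneg (norm_nonneg _) two_ne_zero).1 this
  · have : ‖x - ridgePoint c s x‖ ≠ 0 := norm_ne_zero_iff.2 (sub_ne_zero.2 hx)
    rw [norm_smul, norm_inv, norm_norm, inv_mul_cancel₀ this]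

lemma sub_ridgePoint_eq (x : Plane) :
    x - ridgePoint c s x = ‖x - ridgePoint c s x‖ • outward c s x := by
  unfold outward
  split_ifs with hx
  · rw [← hx]; simp
  · have : ‖x - ridgePoint c s x‖ ≠ 0 := norm_ne_zero_iff.2 (sub_ne_zero.2 hx)
    rw [smul_smul, mul_inv_cancel₀ this, one_smul]

/-- First-order optimality: `ridgeParam` maximizes the concave function `t ↦ 1 - c * t - ‖x - t •
axisVector‖` on `[0, 1]`, and its derivative there is `outward c s x 0 - c` when `x` is off the
ridge. The cases are the two clamped endpoints and the interior. -/
lemma ridge_slackness (h : IsAcuteAngle c s) (x : Plane) {t : ℝ} (h0 : 0 ≤ t) (h1 : t ≤ 1) :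
    0 ≤ (t - ridgeParam c s x) * (c - outward c s x 0) := by
  by_cases hx : x = ridgePoint c s x
  · have : outward c s x 0 = c := by simp [outward, if_pos hx]
    simp [this]
  have hd : 0 < ‖x - ridgePoint c s x‖ := norm_pos_iff.2 (sub_ne_zero.2 hx)
  have e0 := congrArg (fun y : Plane => y 0) (sub_ridgePoint_eq (c := c) (s := s) x)
  have hsq := Plane.norm_sq_eq (x - ridgePoint c s x)
  set d := ‖x - ridgePoint c s x‖
  set N := outward c s x
  set m := ridgeParam c s x with hm
  simp only [ridgePoint, PiLp.sub_apply, PiLp.smul_apply, axisVector_zero, axisVector_one,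
    smul_eq_mul, mul_one, mul_zero, sub_zero, ← hm] at e0 hsq
  obtain ⟨hc, hs, hcs⟩ := h
  have habs : x 1 ^ 2 = |x 1| ^ 2 := (sq_abs _).symm
  have hab := abs_nonneg (x 1)
  suffices 0 ≤ (t - m) * (c * d - (x 0 - m)) by
    rw [e0, show (t - m) * (c * d - d * N 0) = d * ((t - m) * (c - N 0)) by ring] at this
    exact nonneg_of_mul_nonneg_right this hd
  have hdiv : s * (c / s * |x 1|) = c * |x 1| := by field_simp
  rcases le_total (x 0 - c / s * |x 1|) 0 with h2 | h2
  · have hm0 : m = 0 := by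
      rw [hm, ridgeParam, max_eq_left]
      exact (min_le_right _ _).trans h2
    have hw : s * x 0 ≤ c * |x 1| := by nlinarith
    rw [hm0] at hsq ⊢
    rw [sub_zero, sub_zero] at *
    refine mul_nonneg h0 (sub_nonneg.2 ?_)
    rcases le_total (x 0) 0 with h3 | h3
    · exact h3.trans (by positivity)
    · refine abs_le_of_sq_le_sq' ?_ (by positivity) |>.2
      have : (s * x 0) ^ 2 ≤ (c * |x 1|) ^ 2 := by gcongr
      rw [mul_pow, hsq, habs]
      nlinarith
  · rcases le_total 1 (x 0 - c / s * |x 1|) with h3 | h3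
    · have hm1 : m = 1 := by
        rw [hm, ridgeParam, min_eq_left h3, max_eq_right zero_le_one]
      have hw : c * |x 1| ≤ s * (x 0 - 1) := by nlinarith
      rw [hm1] at hsq ⊢
      refine mul_nonneg_of_nonpos_of_nonpos (by linarith) (sub_nonpos.2 ?_)
      have hx0 : 0 ≤ x 0 - 1 := by
        by_contra hneg
        have : s * (x 0 - 1) < 0 := mul_neg_of_pos_of_neg hs (not_le.1 hneg)
        have : 0 ≤ c * |x 1| := by positivity
        linarith
      refine abs_le_of_sq_le_sq' ?_ hx0 |>.2
      have : (c * |x 1|) ^ 2 ≤ (s * (x 0 - 1)) ^ 2 := by gcongr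
      rw [mul_pow, hsq, habs]
      nlinarith
    -- Unclamped case: `x - ridgePoint c s x` is a multiple of `(c, ±s)`, so the derivative vanishes
    -- and equality holds.
    · have hmm : m = x 0 - c / s * |x 1| := by
        rw [hm, ridgeParam, min_eq_right h3, max_eq_right h2]
      have hw : x 0 - m = c / s * |x 1| := by rw [hmm]; ring
      have hd' : d = |x 1| / s := by
        rw [← sq_eq_sq₀ hd.le (by positivity), hsq, hw, habs]
        field_simp
        rw [hcs, mul_one]
      rw [hw, hd']
      apply le_of_eq
      field_simp
      ring

/-- The basic inequality: the affine function on the right supports `height` at `x`. -/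
lemma ridge_cone_le (h : IsAcuteAngle c s) (x y : Plane) {t : ℝ} (h0 : 0 ≤ t) (h1 : t ≤ 1) :
    1 - c * t - ‖y - t • axisVector‖ ≤ height c s x - inner ℝ (outward c s x) (y - x) := by
  have hslack := ridge_slackness h x h0 h1
  have hN := norm_outward h x
  -- Cauchy–Schwarz replaces the cone by an affine function; the remaining dependence on `t` is the
  -- slackness term.
  have k1 : inner ℝ (outward c s x) (y - t • axisVector) ≤ ‖y - t • axisVector‖ := by
    simpa [hN] using real_inner_le_norm (outward c s x) (y - t • axisVector)
  have k2 : inner ℝ (outward c s x) (x - ridgePoint c s x) = ‖x - ridgePoint c s x‖ := by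
    conv_lhs => rw [sub_ridgePoint_eq]
    rw [inner_smul_right, real_inner_self_eq_norm_sq, hN]
    ring
  have k3 : inner ℝ (outward c s x) axisVector = outward c s x 0 := by
    simp [Plane.inner_eq]
  simp only [height, ridgePoint, inner_sub_right, inner_smul_right, k3] at *
  nlinarith

lemma height_le_affine (h : IsAcuteAngle c s) (x y : Plane) :
    height c s y ≤ height c s x - inner ℝ (outward c s x) (y - x) :=
  ridge_cone_le h x y (ridgeParam_nonneg y) (ridgeParam_le_one y)

lemma ridge_cone_le_height (h : IsAcuteAngle c s) (y : Plane) {t : ℝ} (h0 : 0 ≤ t) (h1 : t ≤ 1) :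
    1 - c * t - ‖y - t • axisVector‖ ≤ height c s y := by
  simpa using ridge_cone_le h y y h0 h1

lemma one_sub_norm_le_height (h : IsAcuteAngle c s) (y : Plane) : 1 - ‖y‖ ≤ height c s y := by
  simpa using ridge_cone_le_height h y le_rfl zero_le_one

lemma lipschitzWith_height (h : IsAcuteAngle c s) : LipschitzWith 1 (height c s) := by
  refine LipschitzWith.of_le_add fun x y => ?_
  have h1 := height_le_affine h y x
  have h2 := neg_le_of_abs_le (abs_real_inner_le_norm (outward c s y) (x - y))
  rw [norm_outward h, one_mul, ← dist_eq_norm] at h2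
  linarith

lemma concaveOn_height (h : IsAcuteAngle c s) : ConcaveOn ℝ Set.univ (height c s) := by
  refine ⟨convex_univ, fun x _ y _ a b ha hb hab => ?_⟩
  set z := a • x + b • y with hz
  have h1 := height_le_affine h z x
  have h2 := height_le_affine h z y
  have h3 : a * inner ℝ (outward c s z) (x - z) + b * inner ℝ (outward c s z) (y - z) = 0 := by
    rw [← inner_smul_right, ← inner_smul_right, ← inner_add_right]
    have : a • (x - z) + b • (y - z) = 0 := by
      rw [smul_sub, smul_sub, sub_add_sub_comm, ← add_smul, hab, one_smul, ← hz, sub_self]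
    rw [this, inner_zero_right]
  simp only [smul_eq_mul]
  have h4 := mul_le_mul_of_nonneg_left h1 ha
  have h5 := mul_le_mul_of_nonneg_left h2 hb
  have : height c s z = a * height c s z + b * height c s z := by rw [← add_mul, hab, one_mul]
  linarith

lemma HasGradientAt.squeeze {l f u : Plane → ℝ} {a x : Plane} (hl : HasGradientAt l a x)
    (hu : HasGradientAt u a x) (hlf : ∀ y, l y ≤ f y) (hfu : ∀ y, f y ≤ u y) (hlx : l x = f x)
    (hux : u x = f x) : HasGradientAt f a x := by
  rw [hasGradientAt_iff_isLittleO] at *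
  refine (Asymptotics.isBigO_of_le _ fun y => ?_).trans_isLittleO (hl.norm_left.add hu.norm_left)
  have h1 := hlf y
  have h2 := hfu y
  rw [Real.norm_of_nonneg (add_nonneg (norm_nonneg _) (norm_nonneg _)), Real.norm_eq_abs,
    Real.norm_eq_abs, Real.norm_eq_abs, abs_le]
  constructor
  · have := neg_abs_le (l y - l x - inner ℝ a (y - x))
    have := abs_nonneg (u y - u x - inner ℝ a (y - x))
    linarith
  · have := abs_nonneg (l y - l x - inner ℝ a (y - x))
    have := le_abs_self (u y - u x - inner ℝ a (y - x))
    linarith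

lemma hasGradientAt_norm_sub {x z : Plane} (hx : x ≠ z) :
    HasGradientAt (fun y => ‖y - z‖) (‖x - z‖⁻¹ • (x - z)) x := by
  have h0 : ‖x - z‖ ≠ 0 := norm_ne_zero_iff.2 (sub_ne_zero.2 hx)
  have h1 : HasFDerivAt (fun y : Plane => ‖y - z‖ ^ 2) _ x :=
    ((hasFDerivAt_id x).sub_const z).norm_sq
  have h2 := h1.sqrt (by positivity)
  simp only [Real.sqrt_sq (norm_nonneg _)] at h2
  rw [hasGradientAt_iff_hasFDerivAt]
  refine h2.congr_fderiv ?_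
  ext v
  simp
  field_simp

/-- Squeezed at `x` between the cone with vertex frozen at `ridgePoint c s x` and the supporting
affine function, which have the same gradient. -/
lemma hasGradientAt_height (h : IsAcuteAngle c s) {x : Plane} (hx : x ≠ ridgePoint c s x) :
    HasGradientAt (height c s) (-outward c s x) x := by
  refine HasGradientAt.squeeze
    (l := fun y => 1 - c * ridgeParam c s x - ‖y - ridgePoint c s x‖)
    (u := fun y => height c s x - inner ℝ (outward c s x) (y - x)) ?_ ?_
    (fun y => ridge_cone_le_height h y (ridgeParam_nonneg x) (ridgeParam_le_one x))
    (fun y => height_le_affine h x y) rfl (by simp)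
  · have h1 := (hasGradientAt_norm_sub hx).hasFDerivAt.const_sub (1 - c * ridgeParam c s x)
    rw [hasGradientAt_iff_hasFDerivAt, outward, if_neg hx, map_neg]
    exact h1
  · rw [hasGradientAt_iff_isLittleO]
    simp [inner_neg_left]

lemma continuousAt_outward {x : Plane} (hx : x ≠ ridgePoint c s x) :
    ContinuousAt (outward c s) x := by
  have hr := continuous_ridgePoint (c := c) (s := s)
  have h1 : ContinuousAt
      (fun y => ‖y - ridgePoint c s y‖⁻¹ • (y - ridgePoint c s y)) x := by
    have : ‖x - ridgePoint c s x‖ ≠ 0 := norm_ne_zero_iff.2 (sub_ne_zero.2 hx)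
    have h2 : ContinuousAt (fun y => y - ridgePoint c s y) x := by fun_prop
    exact (h2.norm.inv₀ this).smul h2
  refine h1.congr ?_
  have : {y | y ≠ ridgePoint c s y} ∈ 𝓝 x :=
    (isOpen_ne_fun continuous_id hr).mem_nhds hx
  filter_upwards [this] with y hy
  rw [outward, if_neg hy]

lemma coord_one_eq_zero_of_eq_ridgePoint {x : Plane} (hx : x = ridgePoint c s x) : x 1 = 0 := by
  rw [hx]; simp [ridgePoint]

lemma ae_coord_one_ne_zero : ∀ᵐ x : Plane, x 1 ≠ 0 := by
  have h := Measure.addHaar_submodule (volume : Measure Plane)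
    (LinearMap.ker (EuclideanSpace.proj (𝕜 := ℝ) (1 : Fin 2) : Plane →L[ℝ] ℝ).toLinearMap) (by
      intro htop
      have : (EuclideanSpace.single 1 1 : Plane) ∈ LinearMap.ker
        (EuclideanSpace.proj (𝕜 := ℝ) (1 : Fin 2) : Plane →L[ℝ] ℝ).toLinearMap := by
        rw [htop]; trivial
      simp at this)
  rw [ae_iff]
  convert h using 2
  ext x
  simp

end Height

/-! ### The cap domain, its distance function and the competitor. -/

section Domain

variable {c s : ℝ}

lemma isConvexDomain_capDomain (h : IsAcuteAngle c s) : IsConvexDomain (capDomain c s) where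
  isOpen := isOpen_lt continuous_const continuous_height
  nonempty := ⟨0, by
    have := one_sub_norm_le_height h (0 : Plane)
    rw [norm_zero] at this
    change 0 < height c s 0
    linarith⟩
  isBounded := by
    refine (Metric.isBounded_closedBall (x := (0 : Plane)) (r := 2)).subset fun x hx => ?_
    have hx' : 0 < height c s x := hx
    rw [mem_closedBall_zero_iff]
    have h1 : ‖x‖ ≤ ‖x - ridgePoint c s x‖ + ‖ridgePoint c s x‖ := by
      simpa using norm_add_le (x - ridgePoint c s x) (ridgePoint c s x)
    have h2 : ‖ridgePoint c s x‖ ≤ 1 := by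
      rw [ridgePoint, norm_smul, norm_axisVector, mul_one,
        Real.norm_of_nonneg (ridgeParam_nonneg x)]
      exact ridgeParam_le_one x
    have h3 := mul_nonneg h.c_pos.le (ridgeParam_nonneg (c := c) (s := s) x)
    unfold height at hx'
    linarith
  convex := by simpa [capDomain] using (concaveOn_height h).convex_gt 0

lemma height_eq_zero_of_mem_frontier {x : Plane} (hx : x ∈ frontier (capDomain c s)) :
    height c s x = 0 :=
  (frontier_lt_subset_eq continuous_const continuous_height hx).symm

/-- The height is 1-Lipschitz and zero on the frontier, so it is at most the distance; along
`outward` it falls at unit speed, so the frontier is reached after exactly that length. -/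
lemma distBoundary_capDomain (h : IsAcuteAngle c s) {x : Plane} (hx : x ∈ capDomain c s) :
    distBoundary (capDomain c s) x = height c s x := by
  have hx0 : 0 < height c s x := hx
  have hN := norm_outward h x
  have hval : ∀ r : ℝ, height c s (x + r • outward c s x) ≤ height c s x - r := fun r => by
    have := height_le_affine h x (x + r • outward c s x)
    rwa [add_sub_cancel_left, inner_smul_right, real_inner_self_eq_norm_sq, hN, one_pow,
      mul_one] at this
  have hfr : x + height c s x • outward c s x ∈ frontier (capDomain c s) := by
    rw [(isConvexDomain_capDomain h).isOpen.frontier_eq]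
    refine ⟨?_, fun hmem => ?_⟩
    · have htend : Filter.Tendsto (fun r : ℝ => x + r • outward c s x) (𝓝[<] (height c s x))
          (𝓝 (x + height c s x • outward c s x)) :=
        (Continuous.tendsto (by fun_prop) _).mono_left nhdsWithin_le_nhds
      refine mem_closure_of_tendsto htend ?_
      filter_upwards [self_mem_nhdsWithin, mem_nhdsWithin_of_mem_nhds (Ioi_mem_nhds hx0)]
        with r hr hr0
      have hl := (lipschitzWith_height h).dist_le_mul x (x + r • outward c s x)
      rw [dist_self_add_right, norm_smul, hN, mul_one, NNReal.coe_one, one_mul,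
        Real.norm_of_nonneg (le_of_lt hr0), Real.dist_eq] at hl
      have := le_abs_self (height c s x - height c s (x + r • outward c s x))
      have hr' : r < height c s x := hr
      change 0 < height c s (x + r • outward c s x)
      linarith
    · have h1 : 0 < height c s (x + height c s x • outward c s x) := hmem
      have := hval (height c s x)
      linarith
  apply le_antisymm
  · refine (Metric.infDist_le_dist_of_mem hfr).trans_eq ?_
    rw [dist_self_add_right, norm_smul, hN, mul_one, Real.norm_of_nonneg hx0.le]
  · refine (Metric.le_infDist ⟨_, hfr⟩).2 fun z hz => ?_
    have hl := (lipschitzWith_height h).dist_le_mul x z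
    rw [height_eq_zero_of_mem_frontier hz, NNReal.coe_one, one_mul, Real.dist_eq, sub_zero,
      abs_of_pos hx0] at hl
    exact hl

lemma gradient_eq_of_eqOn {φ ψ : Plane → ℝ} {Ω : Set Plane} (hΩ : IsOpen Ω) (h : Set.EqOn φ ψ Ω)
    {x : Plane} (hx : x ∈ Ω) : gradient φ x = gradient ψ x := by
  rw [gradient, gradient, Filter.EventuallyEq.fderiv_eq (h.eventuallyEq_of_mem (hΩ.mem_nhds hx))]

lemma gradient_distBoundary (h : IsAcuteAngle c s) {x : Plane} (hx : x ∈ capDomain c s)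
    (hx1 : x 1 ≠ 0) : gradient (distBoundary (capDomain c s)) x = -outward c s x := by
  rw [gradient_eq_of_eqOn (isConvexDomain_capDomain h).isOpen
    (fun y hy => distBoundary_capDomain h hy) hx]
  exact (hasGradientAt_height h fun hh => hx1 (coord_one_eq_zero_of_eq_ridgePoint hh)).gradient

lemma distBoundary_mem_streamFunctionsZero (h : IsAcuteAngle c s) :
    distBoundary (capDomain c s) ∈ streamFunctionsZero (capDomain c s) := by
  have hΩ := isConvexDomain_capDomain h
  have hlip : LipschitzWith 1 (distBoundary (capDomain c s)) := Metric.lipschitz_infDist_pt _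
  refine ⟨⟨⟨1, hlip.lipschitzOnWith⟩, ?_, ?_⟩, hlip.continuous.continuousOn, fun x hx => ?_⟩
  · rw [ae_restrict_iff' hΩ.isOpen.measurableSet]
    filter_upwards [ae_coord_one_ne_zero] with x hx1 hx
    rw [gradient_distBoundary h hx hx1, norm_neg, norm_outward h]
  · refine isBVField_gradient_of_sub_convex (g := fun _ => 0) (h := fun x => -height c s x)
      (LipschitzWith.const 0) (lipschitzWith_height h).neg (convexOn_const 0 convex_univ)
      (concaveOn_height h).neg hΩ.isBounded hΩ.isOpen fun x hx => ?_
    rw [distBoundary_capDomain h hx]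
    ring
  · exact Metric.infDist_zero_of_mem hx

/-- The competitor, built from the negative distance function of the unit disc. -/
noncomputable def vortex (c s : ℝ) (x : Plane) : ℝ := min (‖x‖ - 1) (height c s x)

/-- A differentiable minimum of two functions touches one of them from below at `x`, and so shares
its gradient there. -/
lemma gradient_vortex (h : IsAcuteAngle c s) {x : Plane} (hx1 : x 1 ≠ 0)
    (hd : DifferentiableAt ℝ (vortex c s) x) :
    gradient (vortex c s) x = ‖x‖⁻¹ • x ∨ gradient (vortex c s) x = -outward c s x := by
  have touch : ∀ {f : Plane → ℝ} {a : Plane}, HasGradientAt f a x →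
      (∀ y, vortex c s y ≤ f y) → vortex c s x = f x → gradient (vortex c s) x = a := by
    intro f a hf hle heq
    have hmax : IsLocalMax (fun y => vortex c s y - f y) x :=
      Filter.Eventually.of_forall fun y => by
        change vortex c s y - f y ≤ vortex c s x - f x
        rw [heq, sub_self]
        exact sub_nonpos.2 (hle y)
    have h1 := hmax.fderiv_eq_zero
    have h2 : fderiv ℝ (fun y => vortex c s y - f y) x = _ :=
      (hd.hasFDerivAt.sub hf.hasFDerivAt).fderiv
    rw [h2, sub_eq_zero] at h1
    rw [gradient, h1, LinearIsometryEquiv.symm_apply_apply]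
  rcases le_total (‖x‖ - 1) (height c s x) with hle | hle
  · left
    have hx0 : x ≠ 0 := fun h0 => hx1 (by rw [h0]; rfl)
    have h1 := (hasGradientAt_norm_sub hx0).hasFDerivAt.sub_const 1
    simp only [sub_zero] at h1
    exact touch (f := fun y => ‖y‖ - 1) h1 (fun y => min_le_left _ _) (min_eq_left hle)
  · right
    exact touch (hasGradientAt_height h fun hh => hx1 (coord_one_eq_zero_of_eq_ridgePoint hh))
      (fun y => min_le_right _ _) (min_eq_right hle)

lemma lipschitzWith_norm_sub_one : LipschitzWith 1 (fun x : Plane => ‖x‖ - 1) := by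
  simpa using (lipschitzWith_one_norm (E := Plane)).sub (LipschitzWith.const 1)

lemma lipschitzWith_vortex (h : IsAcuteAngle c s) : LipschitzWith 1 (vortex c s) := by
  have := lipschitzWith_norm_sub_one.min (lipschitzWith_height h)
  rwa [max_self] at this

lemma vortex_mem_streamFunctionsZero (h : IsAcuteAngle c s) :
    vortex c s ∈ streamFunctionsZero (capDomain c s) := by
  have hΩ := isConvexDomain_capDomain h
  have hlip := lipschitzWith_vortex h
  refine ⟨⟨⟨1, hlip.lipschitzOnWith⟩, ?_, ?_⟩, hlip.continuous.continuousOn, fun x hx => ?_⟩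
  · refine ae_restrict_of_ae ?_
    filter_upwards [ae_coord_one_ne_zero, hlip.ae_differentiableAt (μ := volume)] with x hx1 hd
    rcases gradient_vortex h hx1 hd with h1 | h1
    · have hx0 : ‖x‖ ≠ 0 := norm_ne_zero_iff.2 fun h0 => hx1 (by rw [h0]; rfl)
      rw [h1, norm_smul, norm_inv, norm_norm, inv_mul_cancel₀ hx0]
    · rw [h1, norm_neg, norm_outward h]
  · have hcn : ConvexOn ℝ Set.univ (fun x : Plane => ‖x‖ - 1) :=
      (convexOn_norm convex_univ).sub (concaveOn_const 1 convex_univ)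
    -- With `u` convex and `w` concave, `min u w = u - max (u - w) 0` is a difference of convex
    -- functions.
    refine isBVField_gradient_of_sub_convex (g := fun x => ‖x‖ - 1)
      (h := fun x => max (‖x‖ - 1 - height c s x) 0) (Kh := max (1 + 1) 0)
      lipschitzWith_norm_sub_one
      ((lipschitzWith_norm_sub_one.sub (lipschitzWith_height h)).max (LipschitzWith.const 0))
      hcn ((hcn.sub (concaveOn_height h)).sup (convexOn_const 0 convex_univ))
      hΩ.isBounded hΩ.isOpen fun x _ => ?_
    unfold vortex
    rcases le_total (‖x‖ - 1) (height c s x) with hle | hle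
    · rw [min_eq_left hle, max_eq_right (by linarith)]; ring
    · rw [min_eq_right hle, max_eq_left (by linarith)]; ring
  -- The frontier lies outside the open unit disc, so the minimum there is the height, which is
  -- zero.
  · have h1 := height_eq_zero_of_mem_frontier hx
    have h2 := one_sub_norm_le_height h x
    rw [vortex, h1, min_eq_right]
    linarith

end Domain

/-! ### One-sided traces of fields with two continuous branches. -/

section Traces

variable {u P Q : Plane → Plane} {x ν a b : Plane} {U : Set Plane}

lemma isOpen_halfBall (x ν : Plane) (r : ℝ) : IsOpen (halfBall x ν r) :=
  have hc : Continuous fun y : Plane => inner ℝ ν (y - x) := by fun_prop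
  Metric.isOpen_ball.inter (isOpen_lt continuous_const hc)

lemma halfBall_subset_ball (x ν : Plane) (r : ℝ) : halfBall x ν r ⊆ Metric.ball x r :=
  fun _ h => h.1

lemma nonempty_halfBall (hν : ‖ν‖ = 1) {r : ℝ} (hr : 0 < r) : (halfBall x ν r).Nonempty := by
  refine ⟨x + (r / 2) • ν, ?_, ?_⟩
  · rw [mem_ball_iff_norm, add_sub_cancel_left, norm_smul, hν, mul_one,
      Real.norm_of_nonneg (by positivity)]
    linarith
  · rw [add_sub_cancel_left, inner_smul_right, real_inner_self_eq_norm_sq, hν]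
    positivity

/-- If `a` differed from both branch values, `‖u y - a‖` would stay above a fixed `η` almost
everywhere near `x`, and so would its averages. -/
lemma HasTrace.eq_or_eq (hν : ‖ν‖ = 1) (hP : ContinuousAt P x) (hQ : ContinuousAt Q x)
    (hU : U ∈ 𝓝 x) (hu : ∀ᵐ y, y ∈ U → u y = P y ∨ u y = Q y) (h : HasTrace u x ν a) :
    a = P x ∨ a = Q x := by
  by_contra! hne
  obtain ⟨hne1, hne2⟩ := hne
  obtain ⟨η, hη, hη1, hη2⟩ : ∃ η : ℝ, 0 < η ∧ η < ‖P x - a‖ ∧ η < ‖Q x - a‖ := by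
    obtain ⟨η, h0, h1⟩ := exists_between
      (lt_min (norm_pos_iff.2 (sub_ne_zero.2 hne1.symm)) (norm_pos_iff.2 (sub_ne_zero.2 hne2.symm)))
    exact ⟨η, h0, lt_min_iff.1 h1⟩
  have hP' : ∀ᶠ y in 𝓝 x, η < ‖P y - a‖ :=
    (hP.sub continuousAt_const).norm.eventually (lt_mem_nhds hη1)
  have hQ' : ∀ᶠ y in 𝓝 x, η < ‖Q y - a‖ :=
    (hQ.sub continuousAt_const).norm.eventually (lt_mem_nhds hη2)
  obtain ⟨r₀, hr₀, hball⟩ := Metric.mem_nhds_iff.1 (Filter.inter_mem (hP'.and hQ') hU)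
  have hsmall : ∀ᶠ r in 𝓝[>] (0 : ℝ),
      ⨍⁻ y in halfBall x ν r, ‖u y - a‖ₑ ∂volume < ENNReal.ofReal η :=
    h.eventually (gt_mem_nhds (ENNReal.ofReal_pos.2 hη))
  obtain ⟨r, hr, hr1, hr0⟩ := (hsmall.and
    (Filter.Eventually.and (mem_nhdsWithin_of_mem_nhds (Iio_mem_nhds hr₀))
      self_mem_nhdsWithin)).exists
  have hpos : volume (halfBall x ν r) ≠ 0 :=
    ((isOpen_halfBall x ν r).measure_pos volume (nonempty_halfBall hν hr0)).ne'
  have hfin : volume (halfBall x ν r) ≠ ⊤ :=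
    ((measure_mono (halfBall_subset_ball x ν r)).trans_lt measure_ball_lt_top).ne
  refine absurd hr (not_lt.2 ?_)
  rw [← setLAverage_const hpos hfin (ENNReal.ofReal η), setLAverage_eq, setLAverage_eq]
  refine ENNReal.div_le_div_right
    (setLIntegral_mono_ae' (isOpen_halfBall x ν r).measurableSet ?_) _
  filter_upwards [hu] with y hy hyr
  have hyb := hball (Metric.ball_subset_ball (le_of_lt hr1) (halfBall_subset_ball x ν r hyr))
  rw [← ofReal_norm]
  refine ENNReal.ofReal_le_ofReal ?_
  rcases hy hyb.2 with h1 | h1 <;> rw [h1]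
  exacts [hyb.1.1.le, hyb.1.2.le]

lemma hasTrace_of_eqOn {r₀ : ℝ} (hr₀ : 0 < r₀) (h : ∀ y ∈ halfBall x ν r₀, u y = a) :
    HasTrace u x ν a := by
  refine tendsto_const_nhds.congr' ?_
  filter_upwards [mem_nhdsWithin_of_mem_nhds (Iio_mem_nhds hr₀)] with r hr
  rw [setLAverage_eq, setLIntegral_congr_fun (g := fun _ => 0)
    (isOpen_halfBall x ν r).measurableSet fun y hy => by
      simp [h y ⟨Metric.ball_subset_ball (le_of_lt hr) hy.1, hy.2⟩]]
  simp

lemma IsJumpAt.norm_sub_eq (hP : ContinuousAt P x) (hQ : ContinuousAt Q x)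
    (hU : U ∈ 𝓝 x) (hu : ∀ᵐ y, y ∈ U → u y = P y ∨ u y = Q y) (h : IsJumpAt u x ν a b) :
    P x ≠ Q x ∧ ‖a - b‖ = ‖P x - Q x‖ := by
  obtain ⟨hν, hab, ha, hb⟩ := h
  have hν' : ‖-ν‖ = 1 := by rwa [norm_neg]
  rcases ha.eq_or_eq hν hP hQ hU hu with h1 | h1 <;>
  rcases hb.eq_or_eq hν' hP hQ hU hu with h2 | h2
  · exact absurd (h1.trans h2.symm) hab
  · rw [h1, h2] at hab ⊢
    exact ⟨hab, rfl⟩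
  · rw [h1, h2] at hab ⊢
    exact ⟨hab.symm, norm_sub_rev _ _⟩
  · exact absurd (h1.trans h2.symm) hab

/-- Distinct traces must exhaust the two branch values, so every admissible triple gives the same
size and the choice in `jumpSize` is harmless. Taking `P = Q` excludes a jump. -/
lemma jumpSize_eq (hP : ContinuousAt P x) (hQ : ContinuousAt Q x)
    (hU : U ∈ 𝓝 x) (hu : ∀ᵐ y, y ∈ U → u y = P y ∨ u y = Q y) (h : IsJumpAt u x ν a b) :
    P x ≠ Q x ∧ jumpSize u x = ‖P x - Q x‖ := by
  have hex : ∃ p : Plane × Plane × Plane, IsJumpAt u x p.1 p.2.1 p.2.2 := ⟨(ν, a, b), h⟩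
  rw [jumpSize, dif_pos hex]
  exact hex.choose_spec.norm_sub_eq hP hQ hU hu

end Traces

/-! ### Lower bound on the ridge, upper bound on the wall. -/

section Energies

variable {c s : ℝ}

lemma IsAcuteAngle.c_lt_one (h : IsAcuteAngle c s) : c < 1 := by
  nlinarith [h.c_pos, h.s_pos, h.sq_add_sq]

lemma outward_of_mem_strip (h : IsAcuteAngle c s) {y : Plane} (h0 : 0 ≤ y 0 - c / s * |y 1|)
    (h1 : y 0 - c / s * |y 1| ≤ 1) (hy : y 1 ≠ 0) {σ : ℝ} (hσ : |y 1| * σ = y 1) :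
    outward c s y = !₂[c, σ * s] := by
  have hne : y ≠ ridgePoint c s y := fun hh => hy (coord_one_eq_zero_of_eq_ridgePoint hh)
  have hs := h.s_pos
  have hp := abs_pos.2 hy
  have hm : ridgeParam c s y = y 0 - c / s * |y 1| := by
    rw [ridgeParam, min_eq_right h1, max_eq_right h0]
  have c0 : (y - ridgePoint c s y) 0 = c / s * |y 1| := by
    simp [ridgePoint, hm]
  have c1 : (y - ridgePoint c s y) 1 = |y 1| * σ := by
    simp [ridgePoint, hσ]
  have hn : ‖y - ridgePoint c s y‖ = |y 1| / s := by
    rw [← sq_eq_sq₀ (norm_nonneg _) (by positivity), Plane.norm_sq_eq, c0, c1, hσ, ← sq_abs (y 1)]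
    field_simp
    exact h.sq_add_sq
  rw [outward, if_neg hne, hn]
  ext i
  fin_cases i
  · change (|y 1| / s)⁻¹ * (y - ridgePoint c s y) 0 = c
    rw [c0]
    field_simp
  · change (|y 1| / s)⁻¹ * (y - ridgePoint c s y) 1 = σ * s
    rw [c1]
    field_simp

/-- The relative interior of the ridge of the cap domain. -/
def ridge : Set Plane := {x | x 1 = 0 ∧ 0 < x 0 ∧ x 0 < 1}

lemma measurableSet_ridge : MeasurableSet ridge :=
  have hc (i : Fin 2) : Continuous fun x : Plane => x i := by fun_prop
  (isClosed_eq (hc 1) continuous_const).measurableSet.inter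
    ((isOpen_lt continuous_const (hc 0)).measurableSet.inter
    (isOpen_lt (hc 0) continuous_const).measurableSet)

lemma one_le_hausdorffMeasure_ridge : 1 ≤ Measure.hausdorffMeasure 1 ridge := by
  have hseg : Measure.hausdorffMeasure 1 (segment ℝ 0 axisVector) = 1 := by
    rw [hausdorffMeasure_segment, edist_dist, dist_zero_left, norm_axisVector, ENNReal.ofReal_one]
  have hsub : segment ℝ 0 axisVector ⊆ ridge ∪ ({0} ∪ {axisVector}) := by
    rintro x hx
    rw [segment_eq_image] at hx
    obtain ⟨t, ⟨h0, h1⟩, rfl⟩ := hx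
    rcases h0.eq_or_lt with h0 | h0
    · right; left; simp [← h0]
    rcases h1.eq_or_lt with h1 | h1
    · right; right; simp [h1]
    · left; exact ⟨by simp, by simpa using h0, by simpa using h1⟩
  have := Measure.nullSingletonClass_hausdorff Plane (d := 1) one_pos
  calc 1 = Measure.hausdorffMeasure 1 (segment ℝ 0 axisVector) := hseg.symm
    _ ≤ Measure.hausdorffMeasure 1 (ridge ∪ ({0} ∪ {axisVector})) := measure_mono hsub
    _ ≤ Measure.hausdorffMeasure 1 ridge +
        Measure.hausdorffMeasure 1 ({0} ∪ {axisVector} : Set Plane) := measure_union_le _ _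
    _ = _ := by
      rw [measure_union_null (measure_singleton _) (measure_singleton _), add_zero]

lemma isJumpAt_ridge (h : IsAcuteAngle c s) {x : Plane} (hx : x ∈ ridge) :
    x ∈ jumpSet (capDomain c s) (gradient (distBoundary (capDomain c s))) ∧
      jumpSize (gradient (distBoundary (capDomain c s))) x = 2 * s := by
  obtain ⟨hx1, hx0, hx0'⟩ := hx
  have hs := h.s_pos
  have hxΩ : x ∈ capDomain c s := by
    have h1 := ridge_cone_le_height h x hx0.le hx0'.le
    have h2 : x - x 0 • axisVector = 0 := by
      ext i; fin_cases i
      · simp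
      · simp [hx1]
    rw [h2, norm_zero, sub_zero] at h1
    have : c * x 0 < 1 := by nlinarith [h.c_lt_one, h.c_pos]
    change 0 < height c s x
    linarith
  set u := gradient (distBoundary (capDomain c s)) with hu_def
  have hcont : Continuous fun y : Plane => y 0 - c / s * |y 1| := by fun_prop
  set U := {y : Plane | y ∈ capDomain c s ∧ 0 < y 0 - c / s * |y 1| ∧
      y 0 - c / s * |y 1| < 1}
  have hU : U ∈ 𝓝 x := by
    refine IsOpen.mem_nhds ((isConvexDomain_capDomain h).isOpen.inter
      ((isOpen_lt continuous_const hcont).inter (isOpen_lt hcont continuous_const))) ?_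
    refine ⟨hxΩ, ?_, ?_⟩ <;> simpa [hx1]
  have hup : ∀ y ∈ U, 0 < y 1 → u y = -!₂[c, s] := fun y hy hy1 => by
    rw [hu_def, gradient_distBoundary h hy.1 hy1.ne', outward_of_mem_strip h hy.2.1.le hy.2.2.le
      hy1.ne' (σ := 1) (by rw [abs_of_pos hy1, mul_one]), one_mul]
  have hdown : ∀ y ∈ U, y 1 < 0 → u y = -!₂[c, -s] := fun y hy hy1 => by
    rw [hu_def, gradient_distBoundary h hy.1 hy1.ne, outward_of_mem_strip h hy.2.1.le hy.2.2.le
      hy1.ne (σ := -1) (by rw [abs_of_neg hy1]; ring), neg_one_mul]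
  obtain ⟨r, hr, hrU⟩ := Metric.mem_nhds_iff.1 hU
  have hdiff : (-!₂[c, s] : Plane) - -!₂[c, -s] = (-2 * s) • EuclideanSpace.single 1 (1 : ℝ) := by
    ext i; fin_cases i
    · simp
    · simp; ring
  have hnorm : ‖(-!₂[c, s] : Plane) - -!₂[c, -s]‖ = 2 * s := by
    rw [hdiff, norm_smul]
    simp [abs_of_pos hs]
  have hjump : IsJumpAt u x (EuclideanSpace.single 1 1) (-!₂[c, s]) (-!₂[c, -s]) := by
    refine ⟨by simp, fun heq => ?_, ?_, ?_⟩
    · rw [heq, sub_self, norm_zero] at hnorm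
      linarith
    · refine hasTrace_of_eqOn hr fun y hy => hup y (hrU hy.1) ?_
      have := hy.2
      simpa [EuclideanSpace.inner_single_left, hx1] using this
    · refine hasTrace_of_eqOn hr fun y hy => hdown y (hrU hy.1) ?_
      have := hy.2
      simpa [EuclideanSpace.inner_single_left, hx1, inner_neg_left] using this
  refine ⟨⟨hxΩ, _, _, _, hjump⟩, ?_⟩
  rw [(jumpSize_eq (P := fun _ => -!₂[c, s]) (Q := fun _ => -!₂[c, -s]) continuousAt_const
    continuousAt_const hU ?_ hjump).2, hnorm]
  filter_upwards [ae_coord_one_ne_zero] with y hy hyU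
  rcases lt_or_gt_of_ne hy with h1 | h1
  exacts [Or.inr (hdown y hyU h1), Or.inl (hup y hyU h1)]

lemma le_lineEnergy_distBoundary (f : ℝ → ℝ≥0∞) (h : IsAcuteAngle c s) :
    f (2 * s) ≤ lineEnergy f (capDomain c s) (distBoundary (capDomain c s)) := by
  calc f (2 * s) ≤ f (2 * s) * Measure.hausdorffMeasure 1 ridge :=
        le_mul_of_one_le_right' one_le_hausdorffMeasure_ridge
    _ = ∫⁻ x in ridge, f (jumpSize (gradient (distBoundary (capDomain c s))) x)
          ∂(Measure.hausdorffMeasure 1) := by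
        rw [← setLIntegral_const]
        exact (setLIntegral_congr_fun measurableSet_ridge fun x hx => by
          simp only [(isJumpAt_ridge h hx).2]).symm
    _ ≤ _ := lintegral_mono_set fun x hx => (isJumpAt_ridge h hx).1

/-- The curve along which the gradient of `vortex` jumps. -/
def wall (c s : ℝ) : Set Plane := {x | x ∈ capDomain c s ∧ ‖x‖ - 1 = height c s x}

lemma abs_coord_one_le (h : IsAcuteAngle c s) {v : Plane} (hv : ‖v‖ = 1) (hc : c ≤ v 0) :
    |v 1| ≤ s := by
  have h1 := Plane.norm_sq_eq v
  rw [hv] at h1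
  refine abs_le_of_sq_le_sq ?_ h.s_pos.le
  nlinarith [h.sq_add_sq, h.c_pos]

/-- A wall point lies outside the unit disc, so its ridge parameter is positive and slackness at `t
= 0` puts the outward normal in the cone about the axis. The radial direction inherits this, as `x`
is the sum of a vector in the cone and a multiple of the axis. -/
lemma wall_cone (h : IsAcuteAngle c s) {x : Plane} (hx : x ∈ wall c s) :
    1 < ‖x‖ ∧ c ≤ outward c s x 0 ∧ c ≤ (‖x‖⁻¹ • x) 0 ∧ |x 1| ≤ s := by
  obtain ⟨hxΩ, hw⟩ := hx
  have hpos : 0 < height c s x := hxΩ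
  have hnorm : 1 < ‖x‖ := by linarith
  have hm0 : 0 < ridgeParam c s x := by
    refine lt_of_le_of_ne (ridgeParam_nonneg x) fun h0 => ?_
    have : height c s x = 1 - ‖x‖ := by simp [height, ridgePoint, ← h0]
    linarith
  have hN := norm_outward h x
  have hout : c ≤ outward c s x 0 := by
    have := ridge_slackness h x le_rfl zero_le_one
    by_contra! hlt
    nlinarith
  have e0 : x 0 - ridgeParam c s x = ‖x - ridgePoint c s x‖ * outward c s x 0 := by
    simpa [ridgePoint] using congrArg (fun y : Plane => y 0) (sub_ridgePoint_eq (c := c) (s := s) x)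
  have e1 : x 1 = ‖x - ridgePoint c s x‖ * outward c s x 1 := by
    simpa [ridgePoint] using congrArg (fun y : Plane => y 1) (sub_ridgePoint_eq (c := c) (s := s) x)
  have hd := norm_nonneg (x - ridgePoint c s x)
  have hd1 : ‖x - ridgePoint c s x‖ ≤ 1 := by
    have := mul_pos h.c_pos hm0
    unfold height at hpos
    linarith
  refine ⟨hnorm, hout, ?_, ?_⟩
  · have htri : ‖x‖ ≤ ‖x - ridgePoint c s x‖ + ridgeParam c s x := by
      have h1 := norm_add_le (x - ridgePoint c s x) (ridgePoint c s x)
      have h2 : ‖ridgePoint c s x‖ = ridgeParam c s x := by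
        rw [ridgePoint, norm_smul, norm_axisVector, mul_one, Real.norm_of_nonneg hm0.le]
      rwa [sub_add_cancel, h2] at h1
    have hx0 : c * ‖x‖ ≤ x 0 := by
      nlinarith [h.c_pos, h.c_lt_one]
    rw [PiLp.smul_apply, smul_eq_mul, inv_mul_eq_div, le_div_iff₀ (by linarith)]
    exact hx0
  · have h1 := abs_coord_one_le h hN hout
    rw [e1, abs_mul, abs_of_nonneg hd]
    nlinarith [abs_nonneg (outward c s x 1)]

/-- The wall is a 1-Lipschitz graph over the second coordinate. Comparing the tangent of the convex
norm and the supporting function of the concave height at `x` gives `⟪M + N, y - x⟫ ≤ 0`, with first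
component of `M + N` at least `2 * c` and second at most `2 * s ≤ 2 * c` in absolute value. The
constant `2` is a crude `√2`. -/
lemma dist_le_of_mem_wall (h : IsAcuteAngle c s) (hsc : s ≤ c) {x y : Plane} (hx : x ∈ wall c s)
    (hy : y ∈ wall c s) : dist x y ≤ 2 * |x 1 - y 1| := by
  have key : ∀ {x y : Plane}, x ∈ wall c s → y ∈ wall c s → y 0 - x 0 ≤ |y 1 - x 1| := by
    intro x y hx hy
    obtain ⟨hn, hN0, hM0, -⟩ := wall_cone h hx
    have hNn := norm_outward h x
    have hN1 := abs_coord_one_le h hNn hN0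
    set N := outward c s x with hN
    set M := ‖x‖⁻¹ • x with hM
    have hMn : ‖M‖ = 1 := by
      rw [hM, norm_smul, norm_inv, norm_norm, inv_mul_cancel₀ (by linarith)]
    have hM1 := abs_coord_one_le h hMn hM0
    have h1 := height_le_affine h x y
    have h2 : inner ℝ M (y - x) ≤ ‖y‖ - ‖x‖ := by
      have h3 := real_inner_le_norm M y
      have h4 : inner ℝ M x = ‖x‖ := by
        rw [hM, real_inner_smul_left, real_inner_self_eq_norm_sq]
        field_simp
      rw [hMn, one_mul] at h3
      rw [inner_sub_right, h4]
      linarith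
    have h5 := hx.2
    have h6 := hy.2
    simp only [Plane.inner_eq, PiLp.sub_apply, ← hN] at h1 h2
    by_contra! hlt
    have hd := abs_nonneg (y 1 - x 1)
    have h7 : (2 * c) * (y 0 - x 0) ≤ (N 0 + M 0) * (y 0 - x 0) := by
      apply mul_le_mul_of_nonneg_right <;> linarith
    have h8 : |(N 1 + M 1) * (y 1 - x 1)| ≤ (2 * c) * |y 1 - x 1| := by
      rw [abs_mul]
      refine mul_le_mul_of_nonneg_right ?_ hd
      linarith [abs_add_le (N 1) (M 1)]
    have h9 := neg_abs_le ((N 1 + M 1) * (y 1 - x 1))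
    have h10 := mul_lt_mul_of_pos_left hlt (by linarith [h.c_pos] : 0 < 2 * c)
    nlinarith
  have h1 := key hx hy
  have h2 := key hy hx
  rw [abs_sub_comm] at h1
  have h3 : |x 0 - y 0| ≤ |x 1 - y 1| := abs_le.2 ⟨by linarith, h2⟩
  rw [dist_eq_norm]
  refine abs_le_of_sq_le_sq' ?_ (by positivity) |>.2
  rw [Plane.norm_sq_eq, mul_pow, sq_abs]
  have h4 := sq_le_sq.2 h3
  simp only [PiLp.sub_apply]
  nlinarith [sq_nonneg (x 1 - y 1)]

lemma hausdorffMeasure_wall_le (h : IsAcuteAngle c s) (hsc : s ≤ c) :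
    Measure.hausdorffMeasure 1 (wall c s) ≤ ENNReal.ofReal (4 * s) := by
  have hanti : AntilipschitzWith 2 (fun x : wall c s => x.1 1) :=
    AntilipschitzWith.of_le_mul_dist fun x y => by
      exact dist_le_of_mem_wall h hsc x.2 y.2
  have h1 := hanti.le_hausdorffMeasure_image (d := 1) zero_le_one Set.univ
  have h2 := (isometry_subtype_coe (s := wall c s)).hausdorffMeasure_image (d := 1)
    (Or.inl zero_le_one) Set.univ
  rw [Set.image_univ, Subtype.range_coe] at h2
  have h3 : (fun x : wall c s => x.1 1) '' Set.univ ⊆ Set.Icc (-s) s := by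
    rintro _ ⟨x, -, rfl⟩
    exact abs_le.1 (wall_cone h x.2).2.2.2
  rw [h2]
  refine h1.trans ?_
  rw [hausdorffMeasure_real, ENNReal.rpow_one]
  calc _ ≤ (2 : ℝ≥0∞) * volume (Set.Icc (-s) s) := by gcongr; simp
    _ = _ := by
      rw [Real.volume_Icc, show (2 : ℝ≥0∞) = ENNReal.ofReal 2 by simp,
        ← ENNReal.ofReal_mul zero_le_two]
      ring_nf

lemma continuousAt_normalize {x : Plane} (hx : x ≠ 0) :
    ContinuousAt (fun y : Plane => ‖y‖⁻¹ • y) x :=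
  (continuousAt_id.norm.inv₀ (norm_ne_zero_iff.2 hx)).smul continuousAt_id

/-- Off the wall one branch is active near `x` and its gradient is continuous. On it the jump is `M
+ N`, a sum of two unit vectors with first coordinate at least `c`. -/
lemma jump_vortex (h : IsAcuteAngle c s) {x : Plane} (hx0 : x ≠ 0)
    (hx : x ∈ jumpSet (capDomain c s) (gradient (vortex c s))) :
    x ∈ wall c s ∧ jumpSize (gradient (vortex c s)) x ∈ Set.Icc (2 * c) 2 := by
  obtain ⟨hxΩ, ν, a, b, hj⟩ := hx
  have hpos : 0 < height c s x := hxΩ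
  have hM := continuousAt_normalize hx0
  have hns : Continuous fun y : Plane => ‖y‖ - 1 := by fun_prop
  have hridge : 1 < ‖x‖ → x ≠ ridgePoint c s x := fun hn heq => by
    rw [heq, ridgePoint, norm_smul, norm_axisVector, mul_one,
      Real.norm_of_nonneg (ridgeParam_nonneg x)] at hn
    exact absurd (ridgeParam_le_one x) (not_le.2 hn)
  rcases lt_trichotomy (‖x‖ - 1) (height c s x) with hlt | heq | hgt
  · have hopen : IsOpen {y : Plane | ‖y‖ - 1 < height c s y} := isOpen_lt hns continuous_height
    refine absurd rfl (jumpSize_eq hM hM (Filter.inter_mem (hopen.mem_nhds hlt)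
      (isOpen_ne.mem_nhds hx0)) (Filter.Eventually.of_forall fun y hy => Or.inl ?_) hj).1
    rw [gradient_eq_of_eqOn (φ := vortex c s) hopen (ψ := fun y => ‖y‖ - 1)
      (fun z hz => min_eq_left (le_of_lt hz)) hy.1]
    have h1 := (hasGradientAt_norm_sub (z := 0) hy.2).hasFDerivAt.sub_const 1
    simp only [sub_zero] at h1
    exact HasGradientAt.gradient h1
  · have hw : x ∈ wall c s := ⟨hxΩ, heq⟩
    obtain ⟨hn, hN0, hM0, -⟩ := wall_cone h hw
    have hsize := (jumpSize_eq hM (continuousAt_outward (hridge hn)).neg Filter.univ_mem (by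
      filter_upwards [ae_coord_one_ne_zero,
        (lipschitzWith_vortex h).ae_differentiableAt (μ := volume)] with y hy1 hd _
      exact gradient_vortex h hy1 hd) hj).2
    refine ⟨hw, ?_⟩
    simp only [Pi.neg_apply, sub_neg_eq_add] at hsize
    rw [hsize]
    constructor
    · have h1 := PiLp.norm_apply_le (‖x‖⁻¹ • x + outward c s x) 0
      have h2 := (le_abs_self _).trans h1
      rw [PiLp.add_apply] at h2
      linarith
    · refine (norm_add_le _ _).trans ?_
      rw [norm_smul, norm_inv, norm_norm, inv_mul_cancel₀ (by linarith), norm_outward h]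
      norm_num
  · have hopen : IsOpen {y : Plane | height c s y < ‖y‖ - 1} := isOpen_lt continuous_height hns
    have hne := hridge (by linarith)
    have hN : ContinuousAt (fun y => -outward c s y) x := (continuousAt_outward hne).neg
    refine absurd rfl (jumpSize_eq hN hN (Filter.inter_mem (hopen.mem_nhds hgt)
      ((isOpen_ne_fun continuous_id continuous_ridgePoint).mem_nhds hne))
      (Filter.Eventually.of_forall fun y hy => Or.inl ?_) hj).1
    rw [gradient_eq_of_eqOn (φ := vortex c s) hopen (ψ := height c s)
      (fun z hz => min_eq_right (le_of_lt hz)) hy.1]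
    exact (hasGradientAt_height h hy.2).gradient

/-- A bound for the integral over a set which need not be measurable. -/
lemma setLIntegral_le_const_mul {α : Type*} [MeasurableSpace α] {μ : Measure α} {J : Set α}
    {g : α → ℝ≥0∞} {C : ℝ≥0∞} (hg : ∀ᵐ x ∂μ, x ∈ J → g x ≤ C) : ∫⁻ x in J, g x ∂μ ≤ C * μ J := by
  -- A measurable minorant with the same integral avoids any measurability of `J` or `g`.
  obtain ⟨g', hm, hle, heq⟩ := exists_measurable_le_lintegral_eq (μ.restrict J) g
  rw [heq, ← setLIntegral_const]
  refine lintegral_mono_ae ?_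
  rw [ae_restrict_iff (measurableSet_le hm measurable_const)]
  filter_upwards [hg] with x hx hxJ
  exact (hle x).trans (hx hxJ)

lemma lineEnergy_vortex_le {f : ℝ → ℝ≥0∞} {C : ℝ≥0∞} (h : IsAcuteAngle c s) (hsc : s ≤ c)
    (hf : ∀ r ∈ Set.Icc (2 * c) 2, f r ≤ C) :
    lineEnergy f (capDomain c s) (vortex c s) ≤ C * ENNReal.ofReal (4 * s) := by
  have := Measure.nullSingletonClass_hausdorff Plane (d := 1) one_pos
  have hne : ∀ᵐ x ∂(Measure.hausdorffMeasure 1 : Measure Plane), x ≠ 0 := by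
    simp [ae_iff]
  refine (setLIntegral_le_const_mul (C := C) ?_).trans ?_
  · filter_upwards [hne] with x hx hxJ
    exact hf _ (jump_vortex h hx hxJ).2
  · refine mul_le_mul_right ((measure_mono_ae ?_).trans (hausdorffMeasure_wall_le h hsc)) C
    filter_upwards [hne] with x hx hxJ
    exact (jump_vortex h hx hxJ).1

end Energies

theorem proposition1 (f : ℝ → ℝ≥0∞) :
    ∃ Ω : Set Plane, IsConvexDomain Ω ∧ distBoundary Ω ∈ streamFunctionsZero Ω ∧
      ((∀ φ ∈ streamFunctionsZero Ω, lineEnergy f Ω (distBoundary Ω) ≤ lineEnergy f Ω φ) →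
        Filter.limsup (fun t : ℝ => f t / ENNReal.ofReal t) (𝓝[Set.Ioc 0 2] 0) ≤
          2 * Filter.limsup f (𝓝[Set.Icc 0 2] 2)) := by
  by_cases hlim : Filter.limsup (fun t : ℝ => f t / ENNReal.ofReal t) (𝓝[Set.Ioc 0 2] 0) ≤
      2 * Filter.limsup f (𝓝[Set.Icc 0 2] 2)
  -- When the inequality already holds, any angle serves.
  · have h : IsAcuteAngle (4 / 5) (3 / 5) := ⟨by norm_num, by norm_num, by norm_num⟩
    exact ⟨_, isConvexDomain_capDomain h, distBoundary_mem_streamFunctionsZero h, fun _ => hlim⟩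
  obtain ⟨A, hA1, hA2⟩ := exists_between (not_le.1 hlim)
  have hA3 : Filter.limsup f (𝓝[Set.Icc 0 2] 2) < A / 2 := by
    rwa [ENNReal.lt_div_iff_mul_lt (by simp) (by simp), mul_comm]
  have hev := Filter.eventually_lt_of_limsup_lt hA3
  have hfreq := Filter.frequently_lt_of_lt_limsup (by isBoundedDefault) hA2
  rw [eventually_nhdsWithin_iff, Metric.eventually_nhds_iff] at hev
  obtain ⟨ε, hε, hev⟩ := hev
  -- For small `t` the whole range `[2 * c, 2]` of wall jumps falls where `f < A / 2`; `t < 1`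
  -- ensures `s ≤ c`.
  have hcos : ∀ᶠ t : ℝ in 𝓝[Set.Ioc 0 2] 0, t < 1 ∧ 2 - ε < 2 * √(1 - (t / 2) ^ 2) := by
    refine nhdsWithin_le_nhds (Filter.Eventually.and (gt_mem_nhds one_pos) ?_)
    have hcont : Continuous fun t : ℝ => 2 * √(1 - (t / 2) ^ 2) := by fun_prop
    refine hcont.continuousAt.eventually (lt_mem_nhds ?_)
    simpa using hε
  obtain ⟨t, hft, ⟨ht1, htc⟩, ht0, -⟩ :=
    (hfreq.and_eventually (hcos.and self_mem_nhdsWithin)).exists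
  have hnn : (3 / 4 : ℝ) ≤ 1 - (t / 2) ^ 2 := by nlinarith
  have hsq : √(1 - (t / 2) ^ 2) ^ 2 = 1 - (t / 2) ^ 2 := Real.sq_sqrt (by linarith)
  have hcpos : 0 < √(1 - (t / 2) ^ 2) := Real.sqrt_pos.2 (by linarith)
  have h : IsAcuteAngle √(1 - (t / 2) ^ 2) (t / 2) := ⟨hcpos, by positivity, by linarith⟩
  have hsc : t / 2 ≤ √(1 - (t / 2) ^ 2) := Real.le_sqrt_of_sq_le (by nlinarith)
  refine ⟨_, isConvexDomain_capDomain h, distBoundary_mem_streamFunctionsZero h, fun hmin => ?_⟩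
  exfalso
  have hle := (le_lineEnergy_distBoundary f h).trans (hmin _ (vortex_mem_streamFunctionsZero h))
  have hup := lineEnergy_vortex_le (f := f) (C := A / 2) h hsc fun r hr =>
    (hev (by rw [Real.dist_eq, abs_lt]; constructor <;> linarith [hr.1, hr.2])
      ⟨by linarith [hr.1], hr.2⟩).le
  rw [ENNReal.lt_div_iff_mul_lt (by simp [ht0]) (by simp)] at hft
  have hval : A / 2 * ENNReal.ofReal (4 * (t / 2)) = A * ENNReal.ofReal t := by
    rw [show 4 * (t / 2) = 2 * t by ring, ENNReal.ofReal_mul zero_le_two, ENNReal.ofReal_ofNat,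
      ← mul_assoc, ENNReal.div_mul_cancel (by simp) (by simp)]
  rw [mul_div_cancel₀ t two_ne_zero] at hle
  rw [hval] at hup
  exact absurd (hle.trans hup) (not_le.2 hft)
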